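/- Let $0<\alpha\le 1$, let $\lambda,\rho,\kappa$ be real with $\lambda<0$ and $\rho\le 0$, and let $p\in\{1,2\}$, $q\in\{1,2\}$. Let $\omega(z)=\omega(p,\alpha,1,z)$ be either of the generating functions $$\omega(z)=\Big(\sum_{k=1}^p \tfrac1k(1-z)^k\Big)^{\alpha}\qquad\text{or}\qquad \omega(z)=(1-z)^{\alpha}\sum_{k=1}^p g_{k-1}(1-z)^{k-1},\quad g_0=1,\ g_1=\tfrac{\alpha}{2},$$ (principal powers), with Taylor coefficients $\omega(z)=\sum_{n\ge0}\omega_n^{(\alpha)}z^n$. For a step size $\tau>0$ consider the method $$\frac1{\tau^\alpha}\sum_{j=0}^n\omega^{(\alpha)}_{n-j}(U_j-U_0)=(\lambda+\rho)U_n-(\rho+\kappa)E^n_q(U),\qquad n\ge q,$$ with arbitrary starting values $U_0,\dots,U_{q-1}\in\mathbb C$, where $E^n_1(U)=U_n-U_{n-1}$ and $E^n_2(U)=U_n-2U_{n-1}+U_{n-2}$. The method is called stable for the step size $\tau$ if every such numerical solution satisfies $U_n\to0$ as $n\to\infty$, and unconditionally stable if it is stable for every $\tau>0$. Let $$\mathbb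 S=\mathbb C\setminus\Big\{\xi\in\mathbb C:\ \xi^\alpha=\frac{\omega(z)}{(\lambda+\rho)-(\rho+\kappa)(1-z)^q}\ \text{for some } |z|\le1\Big\}.$$ If $\kappa>(\lambda-\rho)/2$ in the case $q=1$, or $\kappa>(\lambda-3\rho)/4$ in the case $q=2$, then the method is unconditionally stable. Moreover, the denominator $(\lambda+\rho)-(\rho+\kappa)(1-z)^q$ has no zero in $|z|\le1$, and $(0,\infty)\subset\mathbb S$. -/

import Mathlib

noncomputable section

namespace SemiImplicit

/-- The two families of generating functions: the fractional backward difference formula (`fbdf`)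
and the generalized Newton--Gregory formula (`gngf`). -/
inductive Formula where
  | fbdf
  | gngf

/-- The tabulated Newton--Gregory coefficients `g_k^{(α)}`, `0 ≤ k ≤ 5`
(they are only used for orders `p ≤ 6`; the value for `k ≥ 6` is a placeholder). -/
def gCoeff (α : ℝ) : ℕ → ℝ
  | 0 => 1
  | 1 => α / 2
  | 2 => α ^ 2 / 8 + 5 * α / 24
  | 3 => α ^ 3 / 48 + 5 * α ^ 2 / 48 + α / 8
  | 4 => α ^ 4 / 384 + 5 * α ^ 3 / 192 + 97 * α ^ 2 / 1152 + 251 * α / 2880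
  | 5 => α ^ 5 / 3840 + 5 * α ^ 4 / 1152 + 61 * α ^ 3 / 2304 + 401 * α ^ 2 / 5760
      + 19 * α / 288
  | _ => 0

/-- The generating function `ω(p, α, τ, z)`; complex powers are principal ones. -/
def omega (F : Formula) (p : ℕ) (α τ : ℝ) (z : ℂ) : ℂ :=
  match F with
  | .fbdf => ((1 / (τ : ℂ)) * ∑ k ∈ Finset.Icc 1 p, (1 / (k : ℂ)) * (1 - z) ^ k) ^ (α : ℂ)
  | .gngf => ((1 - z) / (τ : ℂ)) ^ (α : ℂ)
      * ∑ k ∈ Finset.Icc 1 p, (gCoeff α (k - 1) : ℂ) * (1 - z) ^ (k - 1)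

/-- The quadrature weight `ω_n^{(α)}`: the `n`-th Taylor coefficient at `0` of
`z ↦ ω(p, α, 1, z)`. -/
def weight (F : Formula) (p : ℕ) (α : ℝ) (n : ℕ) : ℂ :=
  iteratedDeriv n (omega F p α 1) 0 / (Nat.factorial n : ℂ)

/-- The perturbation `E_q^n(U)`, i.e. the `q`-th backward difference of `U` at `n`
(meaningful for `n ≥ q`); see the two lemmas below for `q = 1, 2`. -/
def perturbation (q : ℕ) (U : ℕ → ℂ) (n : ℕ) : ℂ :=
  ∑ j ∈ Finset.range (q + 1), (-1 : ℂ) ^ j * (Nat.choose q j : ℂ) * U (n - j)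

theorem perturbation_one (U : ℕ → ℂ) (n : ℕ) : perturbation 1 U n = U n - U (n - 1) := by
  simp [perturbation, Finset.sum_range_succ, sub_eq_add_neg]

theorem perturbation_two (U : ℕ → ℂ) (n : ℕ) :
    perturbation 2 U n = U n - 2 * U (n - 1) + U (n - 2) := by
  simp [perturbation, Finset.sum_range_succ, sub_eq_add_neg]

/-- `U` is a numerical solution, with step size `τ`, of the semi-implicit method without correction
terms for the linear right-hand side `f(u, t) = ρ u`. The `q` starting values
`U 0, …, U (q - 1)` are arbitrary; the scheme holds at all levels `n ≥ q`. -/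
def IsNumericalSolution (F : Formula) (p q : ℕ) (α lam ρ κ τ : ℝ) (U : ℕ → ℂ) : Prop :=
  ∀ n : ℕ, q ≤ n →
    (1 / ((τ ^ α : ℝ) : ℂ)) * ∑ j ∈ Finset.range (n + 1), weight F p α (n - j) * (U j - U 0)
      = ((lam : ℂ) + (ρ : ℂ)) * U n - ((ρ : ℂ) + (κ : ℂ)) * perturbation q U n

/-- Stability for the step size `τ`: every numerical solution tends to `0`. -/
def IsStable (F : Formula) (p q : ℕ) (α lam ρ κ τ : ℝ) : Prop :=
  ∀ U : ℕ → ℂ, IsNumericalSolution F p q α lam ρ κ τ U →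
    Filter.Tendsto U Filter.atTop (nhds 0)

/-- Unconditional stability: stability for every step size. -/
def IsUnconditionallyStable (F : Formula) (p q : ℕ) (α lam ρ κ : ℝ) : Prop :=
  ∀ τ : ℝ, 0 < τ → IsStable F p q α lam ρ κ τ

/-- The denominator `(λ + ρ) - (ρ + κ) (1 - z)^q`. -/
def denom (q : ℕ) (lam ρ κ : ℝ) (z : ℂ) : ℂ :=
  ((lam : ℂ) + (ρ : ℂ)) - ((ρ : ℂ) + (κ : ℂ)) * (1 - z) ^ q

/-- The stability region `𝕊`. -/
def stabilityRegion (F : Formula) (p q : ℕ) (α lam ρ κ : ℝ) : Set ℂ :=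
  {ξ : ℂ | ∃ z : ℂ, ‖z‖ ≤ 1 ∧ ξ ^ (α : ℂ) = omega F p α 1 z / denom q lam ρ κ z}ᶜ

end SemiImplicit

end

/-!
Write `w = 1 - z`. For `‖z‖ ≤ 1` every generating function `ω` considered here takes values in the
closed right half plane (`symbol_re_nonneg`), and its imaginary part is never of the sign opposite
to that of `w.im` (`symbol_im_mul_im_nonneg`). The denominator never equals a positive multiple of such a value
(`ne_mul_denom`): either its real part is negative, or `q = 2`, `ρ + κ > 0` and `w.im ≠ 0`, in which
case its imaginary part is nonzero and of the sign opposite to that of `w.im`. Hence `ω - τ^α D`, with `D` the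
denominator, has no zero in the closed disk (`omega_ne_mul_denom`); this settles the statements on
the denominator and on the stability region.

For stability, the scheme says that the generating series of `U` is the Taylor series of
`f(z) = (U₀ ω(z) / (1 - z) + P(z)) / (ω(z) - τ^α D(z))`, where the polynomial `P` of degree less
than `q` absorbs the starting values (`IsNumericalSolution.exists_polynomial`). This is an identity
of formal power series, so no a priori growth bound on `U` is needed. The denominator of `f` is
bounded away from zero and `ω(z) = O(|1 - z|^α)`, so `f` is holomorphic in the disk, continuous up
to the boundary except at `1`, and `O(|1 - z|^(α - 1))`, an integrable singularity on the unit
circle. Its Taylor coefficients are therefore Fourier coefficients of an integrable function on the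
circle, and tend to zero by the Riemann--Lebesgue lemma (`tendsto_taylor_coeff_zero`).
-/

noncomputable section

namespace SemiImplicit

open Filter Topology MeasureTheory Metric

/-! ### The generating functions on the closed unit disk -/

/-- The common normal form `(w (1 + a w))^α (1 + b w)`, with `w = 1 - z`, of the generating
functions of order at most two. -/
def symbol (α a b : ℝ) (w : ℂ) : ℂ :=
  (w * (1 + a * w)) ^ (α : ℂ) * (1 + b * w)

/-- The parameters that occur: `b = 0` for the backward difference formulas, `a = 0` for the
Newton--Gregory formulas. -/
def Admissible (α a b : ℝ) : Prop :=
  (0 ≤ a ∧ a ≤ 1 / 2 ∧ b = 0) ∨ (a = 0 ∧ b = α / 2)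

lemma exists_omega_eq_symbol (F : Formula) {p : ℕ} (α : ℝ) (hp : p = 1 ∨ p = 2) :
    ∃ a b : ℝ, Admissible α a b ∧ ∀ z, omega F p α 1 z = symbol α a b (1 - z) := by
  rcases hp with rfl | rfl <;> cases F
  · exact ⟨0, 0, by simp [Admissible], fun z => by simp [omega, symbol]⟩
  · exact ⟨0, 0, by simp [Admissible], fun z => by simp [omega, symbol, gCoeff]⟩
  · refine ⟨1 / 2, 0, by norm_num [Admissible], fun z => ?_⟩
    have h : Finset.Icc 1 2 = {1, 2} := rfl
    simp only [omega, symbol, h]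
    norm_num
    ring_nf
  · refine ⟨0, α / 2, by simp [Admissible], fun z => ?_⟩
    have h : Finset.Icc 1 2 = {1, 2} := rfl
    simp [omega, symbol, gCoeff, h]

lemma normSq_one_sub_le {z : ℂ} (hz : ‖z‖ ≤ 1) :
    Complex.normSq (1 - z) ≤ 2 * (1 - z).re := by
  have h : ‖z‖ ^ 2 ≤ 1 := by nlinarith [norm_nonneg z]
  rw [← Complex.normSq_eq_norm_sq, Complex.normSq_apply] at h
  simp only [Complex.normSq_apply, Complex.sub_re, Complex.one_re, Complex.sub_im, Complex.one_im]
  nlinarith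

lemma normSq_one_sub_lt {z : ℂ} (hz : ‖z‖ < 1) :
    Complex.normSq (1 - z) < 2 * (1 - z).re := by
  have h : ‖z‖ ^ 2 < 1 := by nlinarith [norm_nonneg z]
  rw [← Complex.normSq_eq_norm_sq, Complex.normSq_apply] at h
  simp only [Complex.normSq_apply, Complex.sub_re, Complex.one_re, Complex.sub_im, Complex.one_im]
  nlinarith

lemma base_re_ge {a : ℝ} (ha : 0 ≤ a) {w : ℂ} (hw : Complex.normSq w ≤ 2 * w.re) :
    w.re * (1 - 2 * a) + 2 * a * w.re ^ 2 ≤ (w * (1 + a * w)).re := by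
  rw [Complex.normSq_apply] at hw
  simp only [Complex.mul_re, Complex.add_re, Complex.one_re, Complex.ofReal_re, Complex.ofReal_im,
    Complex.add_im, Complex.one_im, Complex.mul_im]
  nlinarith [mul_le_mul_of_nonneg_left hw ha]

lemma base_re_nonneg {a : ℝ} (ha : 0 ≤ a) (ha' : a ≤ 1 / 2) {w : ℂ}
    (hw : Complex.normSq w ≤ 2 * w.re) : 0 ≤ (w * (1 + a * w)).re := by
  have h0 : 0 ≤ w.re := by linarith [Complex.normSq_nonneg w]
  refine le_trans ?_ (base_re_ge ha hw)
  have : 0 ≤ 1 - 2 * a := by linarith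
  positivity

lemma base_re_pos {a : ℝ} (ha : 0 ≤ a) (ha' : a ≤ 1 / 2) {w : ℂ}
    (hw : Complex.normSq w < 2 * w.re) : 0 < (w * (1 + a * w)).re := by
  have h0 : 0 < w.re := by linarith [Complex.normSq_nonneg w]
  refine lt_of_lt_of_le ?_ (base_re_ge ha hw.le)
  have h1 : 0 ≤ w.re * (1 - 2 * a) := mul_nonneg h0.le (by linarith)
  rcases ha.eq_or_lt with rfl | ha
  · simpa using h0
  · positivity

lemma Admissible.bounds {α a b : ℝ} (h : Admissible α a b) (hα : 0 < α) :
    0 ≤ a ∧ a ≤ 1 / 2 ∧ 0 ≤ b := by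
  rcases h with ⟨h1, h2, h3⟩ | ⟨h1, h2⟩ <;> subst_vars <;>
    refine ⟨?_, ?_, ?_⟩ <;> linarith

/-- Trigonometric form of the inequality `|α ψ| ≤ |ψ| ≤ π / 2` between the arguments of a power and
of its base. The last part is what keeps the second order Newton--Gregory symbol in the right half
plane. -/
lemma cos_mul_sin_mul_sin_le {α ψ : ℝ} (hα0 : 0 ≤ α) (hα1 : α ≤ 1) (hψ : |ψ| ≤ Real.pi / 2) :
    0 ≤ Real.sin (ψ * α) * Real.sin ψ ∧ 0 ≤ Real.cos (ψ * α) ∧ 0 ≤ Real.cos ψ ∧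
      Real.cos ψ * (Real.sin (ψ * α) * Real.sin ψ) ≤ Real.cos (ψ * α) := by
  wlog h : 0 ≤ ψ
  · simpa using this hα0 hα1 (ψ := -ψ) (by rwa [abs_neg]) (by linarith)
  rw [abs_of_nonneg h] at hψ
  have hπ := Real.pi_pos
  have h1 : 0 ≤ ψ * α := by positivity
  have h2 : ψ * α ≤ ψ := by nlinarith
  have hs := Real.sin_nonneg_of_nonneg_of_le_pi h (by linarith)
  have hsα := Real.sin_nonneg_of_nonneg_of_le_pi h1 (by linarith)
  have hc := Real.cos_nonneg_of_neg_pi_div_two_le_of_le (x := ψ) (by linarith) hψ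
  have hcα := Real.cos_nonneg_of_neg_pi_div_two_le_of_le (x := ψ * α) (by linarith) (by linarith)
  refine ⟨by positivity, hcα, hc, ?_⟩
  -- `tan (α ψ) ≤ tan ψ`, without denominators
  have hd := Real.sin_nonneg_of_nonneg_of_le_pi (x := ψ - ψ * α) (by linarith) (by linarith)
  rw [Real.sin_sub] at hd
  nlinarith [Real.sin_sq_add_cos_sq ψ, mul_nonneg hs hd, mul_nonneg hcα (sq_nonneg (Real.cos ψ))]

lemma cpow_re_nonneg {α : ℝ} (hα0 : 0 ≤ α) (hα1 : α ≤ 1) {v : ℂ} (hv : 0 ≤ v.re) :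
    0 ≤ (v ^ (α : ℂ)).re := by
  rw [Complex.cpow_ofReal_re]
  have h := cos_mul_sin_mul_sin_le hα0 hα1 (Complex.abs_arg_le_pi_div_two_iff.2 hv)
  exact mul_nonneg (by positivity) h.2.1

lemma cpow_im_mul_im_nonneg {α : ℝ} (hα0 : 0 ≤ α) (hα1 : α ≤ 1) {v : ℂ} (hv : 0 ≤ v.re) :
    0 ≤ (v ^ (α : ℂ)).im * v.im := by
  rw [Complex.cpow_ofReal_im]
  have h := cos_mul_sin_mul_sin_le hα0 hα1 (Complex.abs_arg_le_pi_div_two_iff.2 hv)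
  have := mul_nonneg (mul_nonneg (Real.rpow_nonneg (norm_nonneg v) α) (norm_nonneg v)) h.1
  rw [← Complex.norm_mul_sin_arg v]
  nlinarith

/-- On the closed disk the generating functions take values in the closed right half plane. -/
lemma symbol_re_nonneg {α a b : ℝ} (hα0 : 0 < α) (hα1 : α ≤ 1) (hab : Admissible α a b) {w : ℂ}
    (hw : Complex.normSq w ≤ 2 * w.re) : 0 ≤ (symbol α a b w).re := by
  obtain ⟨ha, ha', hb⟩ := hab.bounds hα0
  have hbase := base_re_nonneg ha ha' hw
  by_cases hb0 : b = 0
  · simpa [symbol, hb0] using cpow_re_nonneg hα0.le hα1 hbase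
  · obtain ⟨rfl, rfl⟩ : a = 0 ∧ b = α / 2 := by
      rcases hab with h | h
      exacts [absurd h.2.2 hb0, h]
    have h0 : 0 ≤ w.re := by linarith [Complex.normSq_nonneg w]
    obtain ⟨h1, h2, h3, h4⟩ :=
      cos_mul_sin_mul_sin_le hα0.le hα1 (Complex.abs_arg_le_pi_div_two_iff.2 h0)
    have hr : ‖w‖ ≤ 2 * Real.cos (Complex.arg w) := by
      rcases eq_or_ne w 0 with rfl | hne
      · simp
      · have : 0 < ‖w‖ := norm_pos_iff.2 hne
        rw [Complex.normSq_eq_norm_sq, ← Complex.norm_mul_cos_arg w] at hw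
        nlinarith
    simp only [symbol, Complex.ofReal_zero, zero_mul, add_zero, mul_one, Complex.mul_re,
      Complex.cpow_ofReal_re, Complex.cpow_ofReal_im, Complex.add_re, Complex.one_re,
      Complex.add_im, Complex.one_im, Complex.mul_im, Complex.ofReal_re, Complex.ofReal_im, zero_add,
      sub_zero]
    rw [← Complex.norm_mul_cos_arg w, ← Complex.norm_mul_sin_arg w]
    set r := ‖w‖
    set ψ := Complex.arg w
    have hr0 : 0 ≤ r := norm_nonneg w
    have hrα : 0 ≤ r ^ α := by positivity
    have key : α / 2 * r * (Real.sin (ψ * α) * Real.sin ψ) ≤ Real.cos (ψ * α) := by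
      have h5 : α / 2 * r ≤ Real.cos ψ := by nlinarith
      exact (mul_le_mul_of_nonneg_right h5 h1).trans h4
    have h6 : 0 ≤ Real.cos (ψ * α) * (α / 2 * r * Real.cos ψ) := by positivity
    have := mul_nonneg hrα (add_nonneg (sub_nonneg.2 key) h6)
    nlinarith

/-- The generating functions map each half of the disk, cut along the real axis, to the
corresponding closed half plane. -/
lemma symbol_im_mul_im_nonneg {α a b : ℝ} (hα0 : 0 < α) (hα1 : α ≤ 1) (hab : Admissible α a b)
    {w : ℂ} (hw : Complex.normSq w ≤ 2 * w.re) : 0 ≤ (symbol α a b w).im * w.im := by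
  obtain ⟨ha, ha', hb⟩ := hab.bounds hα0
  have h0 : 0 ≤ w.re := by linarith [Complex.normSq_nonneg w]
  have hbase := base_re_nonneg ha ha' hw
  set v := w * (1 + a * w) with hv
  have hre := cpow_re_nonneg hα0.le hα1 hbase
  have him := cpow_im_mul_im_nonneg hα0.le hα1 hbase
  have hvim : v.im = w.im * (1 + 2 * a * w.re) := by
    simp [hv]; ring
  have hpos : 0 < 1 + 2 * a * w.re := by positivity
  have him' : 0 ≤ (v ^ (α : ℂ)).im * w.im := by
    rw [hvim, ← mul_assoc] at him
    exact nonneg_of_mul_nonneg_left him hpos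
  have : (symbol α a b w).im * w.im
      = (v ^ (α : ℂ)).im * w.im * (1 + b * w.re) + (v ^ (α : ℂ)).re * (b * w.im ^ 2) := by
    simp [symbol, ← hv]; ring
  rw [this]
  positivity

/-- A point of the closed right half plane that lies on the same side of the real axis as `w` is
not a positive multiple of the denominator. -/
lemma ne_mul_denom {q : ℕ} {lam ρ κ : ℝ} (hlam : lam < 0) (hρ : ρ ≤ 0)
    (hκ : (q = 1 ∧ (lam - ρ) / 2 < κ) ∨ (q = 2 ∧ (lam - 3 * ρ) / 4 < κ))
    {z : ℂ} (hz : ‖z‖ ≤ 1) {s : ℝ} (hs : 0 < s) {Ω : ℂ} (hre : 0 ≤ Ω.re)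
    (him : 0 ≤ Ω.im * (1 - z).im) : Ω ≠ s * denom q lam ρ κ z := by
  have hw := normSq_one_sub_le hz
  unfold denom
  set w := 1 - z with hwdef
  clear_value w
  rw [Complex.normSq_apply] at hw
  have h0 : 0 ≤ w.re := by nlinarith [mul_self_nonneg w.re, mul_self_nonneg w.im]
  have h2 : w.re ≤ 2 := by nlinarith [mul_self_nonneg w.im]
  intro h
  rcases hκ with ⟨rfl, hκ⟩ | ⟨rfl, hκ⟩
  · have h1 : Ω.re = s * ((lam + ρ) - (ρ + κ) * w.re) := by
      rw [h]; simp
    have : (lam + ρ) - (ρ + κ) * w.re < 0 := by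
      rcases le_total 0 (ρ + κ) with hk | hk
      · nlinarith [mul_nonneg hk h0]
      · nlinarith [mul_nonneg (neg_nonneg.2 hk) (sub_nonneg.2 h2)]
    nlinarith [mul_pos hs (neg_pos.2 this)]
  · have h1 : Ω.re = s * ((lam + ρ) - (ρ + κ) * (w.re ^ 2 - w.im ^ 2)) := by
      rw [h]; simp [pow_two]
    have h3 : Ω.im = -(s * ((ρ + κ) * (2 * w.re * w.im))) := by
      rw [h]; simp [pow_two]
      exact Or.inl (Or.inl (by ring))
    have key : (lam + ρ) - (ρ + κ) * (w.re ^ 2 - w.im ^ 2) < 0 := by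
      rcases le_total 0 (ρ + κ) with hk | hk
      · -- The imaginary parts force `(ρ + κ) * w.re * w.im = 0`, hence `(ρ + κ) * w.im = 0`.
        rw [h3] at him
        have h4 : (ρ + κ) * (w.re * w.im ^ 2) = 0 := by
          have h5 : 0 ≤ (ρ + κ) * (w.re * w.im ^ 2) := by positivity
          nlinarith
        rcases mul_eq_zero.1 h4 with h5 | h5
        · rw [h5]; linarith
        · have h6 : w.im ^ 2 = 0 := by
            rcases mul_eq_zero.1 h5 with h6 | h6
            · rw [h6] at hw; nlinarith
            · exact h6
          rw [h6]
          nlinarith [mul_nonneg hk (sq_nonneg w.re)]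
      · have h5 : w.re ^ 2 - w.im ^ 2 ≤ 4 := by nlinarith
        nlinarith [mul_nonneg (neg_nonneg.2 hk) (sub_nonneg.2 h5)]
    nlinarith [mul_pos hs (neg_pos.2 key)]

lemma norm_symbol_le {α a b : ℝ} (hα0 : 0 < α) (ha : 0 ≤ a) (hb : 0 ≤ b) {w : ℂ} (hw : ‖w‖ ≤ 2) :
    ‖symbol α a b w‖ ≤ ((1 + a * 2) ^ α * (1 + b * 2)) * ‖w‖ ^ α := by
  have key (c : ℝ) (hc : 0 ≤ c) : ‖1 + (c : ℂ) * w‖ ≤ 1 + c * 2 := by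
    refine (norm_add_le _ _).trans ?_
    rw [norm_one, norm_mul, Complex.norm_real, Real.norm_of_nonneg hc]
    gcongr
  rw [symbol, norm_mul, Complex.norm_cpow_real, norm_mul,
    Real.mul_rpow (norm_nonneg _) (norm_nonneg _)]
  have := key a ha
  have := key b hb
  calc ‖w‖ ^ α * ‖1 + (a : ℂ) * w‖ ^ α * ‖1 + (b : ℂ) * w‖
      ≤ ‖w‖ ^ α * (1 + a * 2) ^ α * (1 + b * 2) := by gcongr
    _ = _ := by ring

lemma continuousOn_omega {F : Formula} {p : ℕ} {α : ℝ} (hα0 : 0 < α) (hp : p = 1 ∨ p = 2) :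
    ContinuousOn (omega F p α 1) (Metric.closedBall 0 1) := by
  obtain ⟨a, b, hab, h⟩ := exists_omega_eq_symbol F α hp
  obtain ⟨ha, ha', hb⟩ := hab.bounds hα0
  rw [funext h]
  intro z hz
  have hz : ‖z‖ ≤ 1 := by simpa using hz
  have hre := base_re_nonneg ha ha' (normSq_one_sub_le hz)
  have hc : ContinuousAt (fun v : ℂ => v ^ (α : ℂ)) ((1 - z) * (1 + a * (1 - z))) :=
    Complex.continuousAt_cpow_const_of_re_pos (Or.inl hre) (by simpa using hα0)
  have hi : ContinuousAt (fun z : ℂ => (1 - z) * (1 + a * (1 - z))) z := by fun_prop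
  have hm : ContinuousAt (fun z : ℂ => 1 + (b : ℂ) * (1 - z)) z := by fun_prop
  exact ((ContinuousAt.comp (f := fun z : ℂ => (1 - z) * (1 + a * (1 - z))) hc hi).mul
    hm).continuousWithinAt

lemma differentiableOn_omega {F : Formula} {p : ℕ} {α : ℝ} (hα0 : 0 < α) (hp : p = 1 ∨ p = 2) :
    DifferentiableOn ℂ (omega F p α 1) (Metric.ball 0 1) := by
  obtain ⟨a, b, hab, h⟩ := exists_omega_eq_symbol F α hp
  obtain ⟨ha, ha', hb⟩ := hab.bounds hα0
  rw [funext h]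
  intro z hz
  have hz : ‖z‖ < 1 := by simpa using hz
  have hre := base_re_pos ha ha' (normSq_one_sub_lt hz)
  have hd : DifferentiableAt ℂ (fun z : ℂ => (1 - z) * (1 + a * (1 - z))) z := by fun_prop
  have hm : DifferentiableAt ℂ (fun z : ℂ => 1 + (b : ℂ) * (1 - z)) z := by fun_prop
  exact ((hd.cpow_const (Or.inl hre)).mul hm).differentiableWithinAt

lemma exists_norm_omega_le {F : Formula} {p : ℕ} {α : ℝ} (hα0 : 0 < α) (hp : p = 1 ∨ p = 2) :
    ∃ C : ℝ, 0 ≤ C ∧ ∀ z : ℂ, ‖z‖ ≤ 1 → ‖omega F p α 1 z‖ ≤ C * ‖1 - z‖ ^ α := by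
  obtain ⟨a, b, hab, h⟩ := exists_omega_eq_symbol F α hp
  obtain ⟨ha, -, hb⟩ := hab.bounds hα0
  refine ⟨(1 + a * 2) ^ α * (1 + b * 2), by positivity, fun z hz => ?_⟩
  rw [h]
  refine norm_symbol_le hα0 ha hb ((norm_sub_le _ _).trans ?_)
  rw [norm_one]; linarith

/-- The root condition: the characteristic function has no zero in the closed unit disk. -/
lemma omega_ne_mul_denom {F : Formula} {p q : ℕ} {α lam ρ κ : ℝ}
    (hα0 : 0 < α) (hα1 : α ≤ 1) (hlam : lam < 0) (hρ : ρ ≤ 0) (hp : p = 1 ∨ p = 2)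
    (hκ : (q = 1 ∧ (lam - ρ) / 2 < κ) ∨ (q = 2 ∧ (lam - 3 * ρ) / 4 < κ))
    {z : ℂ} (hz : ‖z‖ ≤ 1) {s : ℝ} (hs : 0 < s) :
    omega F p α 1 z ≠ s * denom q lam ρ κ z := by
  obtain ⟨a, b, hab, h⟩ := exists_omega_eq_symbol F α hp
  have hw := normSq_one_sub_le hz
  rw [h]
  exact ne_mul_denom hlam hρ hκ hz hs (symbol_re_nonneg hα0 hα1 hab hw)
    (symbol_im_mul_im_nonneg hα0 hα1 hab hw)

lemma denom_ne_zero {q : ℕ} {lam ρ κ : ℝ} (hlam : lam < 0) (hρ : ρ ≤ 0)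
    (hκ : (q = 1 ∧ (lam - ρ) / 2 < κ) ∨ (q = 2 ∧ (lam - 3 * ρ) / 4 < κ))
    {z : ℂ} (hz : ‖z‖ ≤ 1) : denom q lam ρ κ z ≠ 0 := by
  have h := ne_mul_denom hlam hρ hκ hz one_pos (Ω := 0) le_rfl (by simp)
  simpa using h.symm

/-! ### Taylor coefficients of functions with an integrable singularity -/

lemma norm_one_sub_le_two_mul {r θ : ℝ} (hr0 : 0 ≤ r) (hr1 : r ≤ 1) :
    ‖1 - circleMap 0 1 θ‖ ≤ 2 * ‖1 - circleMap 0 r θ‖ := by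
  have h1 : ‖circleMap 0 r θ - circleMap 0 1 θ‖ = 1 - r := by
    rw [circleMap_zero, circleMap_zero, ← sub_mul, norm_mul, Complex.norm_exp_ofReal_mul_I, mul_one,
      ← Complex.ofReal_sub, Complex.norm_real, Real.norm_eq_abs, abs_sub_comm,
      abs_of_nonneg (by linarith)]
  have h2 : 1 - r ≤ ‖1 - circleMap 0 r θ‖ := by
    have := norm_sub_norm_le (1 : ℂ) (circleMap 0 r θ)
    rwa [norm_one, norm_circleMap_zero, abs_of_nonneg hr0] at this
  have h3 := norm_sub_le_norm_sub_add_norm_sub (1 : ℂ) (circleMap 0 r θ) (circleMap 0 1 θ)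
  linarith

lemma min_div_pi_le_norm_one_sub {r θ : ℝ} (hr0 : 0 ≤ r) (hr1 : r ≤ 1) (hθ0 : 0 ≤ θ)
    (hθ : θ ≤ 2 * Real.pi) :
    min θ (2 * Real.pi - θ) / Real.pi ≤ ‖1 - circleMap 0 r θ‖ := by
  have hπ := Real.pi_pos
  have h1 : ‖1 - circleMap 0 1 θ‖ = 2 * Real.sin (θ / 2) := by
    rw [norm_sub_rev, circleMap_zero, Complex.ofReal_one, one_mul, mul_comm,
      Complex.norm_exp_I_mul_ofReal_sub_one, Real.norm_of_nonneg]
    have := Real.sin_nonneg_of_nonneg_of_le_pi (x := θ / 2) (by linarith) (by linarith)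
    positivity
  have h2 : min θ (2 * Real.pi - θ) / Real.pi ≤ Real.sin (θ / 2) := by
    rcases le_total θ Real.pi with h | h
    · have := Real.mul_le_sin (x := θ / 2) (by linarith) (by linarith)
      rw [min_eq_left (by linarith)]
      calc θ / Real.pi = 2 / Real.pi * (θ / 2) := by ring
        _ ≤ _ := this
    · have := Real.mul_le_sin (x := Real.pi - θ / 2) (by linarith) (by linarith)
      rw [Real.sin_pi_sub] at this
      rw [min_eq_right (by linarith)]
      calc (2 * Real.pi - θ) / Real.pi = 2 / Real.pi * (Real.pi - θ / 2) := by ring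
        _ ≤ _ := this
  have h3 := norm_one_sub_le_two_mul (θ := θ) hr0 hr1
  linarith

/-- An integrable majorant, uniform in the radius, of the singularity on circles. -/
lemma norm_one_sub_rpow_le {β r θ : ℝ} (hβ : β ≤ 0) (hr0 : 0 ≤ r) (hr1 : r ≤ 1) (hθ0 : 0 < θ)
    (hθ : θ < 2 * Real.pi) :
    ‖1 - circleMap 0 r θ‖ ^ β
      ≤ (Real.pi⁻¹) ^ β * (θ ^ β + (2 * Real.pi - θ) ^ β) := by
  have hπ := Real.pi_pos
  have hm : 0 < min θ (2 * Real.pi - θ) := lt_min hθ0 (by linarith)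
  have h1 := min_div_pi_le_norm_one_sub hr0 hr1 hθ0.le hθ.le
  refine (Real.rpow_le_rpow_of_nonpos (by positivity) h1 hβ).trans ?_
  rw [div_eq_inv_mul, Real.mul_rpow (by positivity) hm.le]
  have h2 : 0 ≤ θ ^ β := by positivity
  have h3 : 0 ≤ (2 * Real.pi - θ) ^ β := Real.rpow_nonneg (by linarith) _
  gcongr
  rcases min_choice θ (2 * Real.pi - θ) with h | h <;> rw [h] <;> linarith

lemma circleMap_one_ne_one {θ : ℝ} (hθ0 : 0 < θ) (hθ : θ < 2 * Real.pi) :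
    circleMap 0 1 θ ≠ 1 := by
  have hπ := Real.pi_pos
  have h1 := min_div_pi_le_norm_one_sub zero_le_one le_rfl hθ0.le hθ.le
  have hm : 0 < min θ (2 * Real.pi - θ) / Real.pi :=
    div_pos (lt_min hθ0 (by linarith)) hπ
  intro h
  rw [h, sub_self, norm_zero] at h1
  linarith

lemma taylor_coeff_mul_pow_eq_integral {f : ℂ → ℂ} (hd : DifferentiableOn ℂ f (ball 0 1)) (n : ℕ)
    {r : ℝ} (hr0 : 0 < r) (hr1 : r < 1) :
    iteratedDeriv n f 0 / (n.factorial : ℂ) * (r : ℂ) ^ n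
      = (2 * (Real.pi : ℂ))⁻¹ * ∫ θ in (0 : ℝ)..2 * Real.pi,
          Complex.exp (-(n * θ * Complex.I)) * f (circleMap 0 r θ) := by
  have h := (hd.mono (closedBall_subset_ball hr1)).circleIntegral_one_div_sub_center_pow_smul hr0 n
  have hr : (r : ℂ) ≠ 0 := by exact_mod_cast hr0.ne'
  have hπ : (Real.pi : ℂ) ≠ 0 := by exact_mod_cast Real.pi_ne_zero
  have h2 : ∮ z in C(0, r), (1 / (z - 0) ^ (n + 1)) • f z
      = Complex.I * ((r : ℂ) ^ n)⁻¹ * ∫ θ in (0 : ℝ)..2 * Real.pi,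
          Complex.exp (-(n * θ * Complex.I)) * f (circleMap 0 r θ) := by
    rw [circleIntegral, ← intervalIntegral.integral_const_mul]
    congr 1
    ext θ
    have he : Complex.exp (θ * Complex.I) ≠ 0 := Complex.exp_ne_zero _
    rw [deriv_circleMap, Complex.exp_neg, mul_assoc (n : ℂ), Complex.exp_nat_mul, sub_zero,
      circleMap_zero]
    simp only [smul_eq_mul]
    field_simp
    ring
  rw [h2, smul_eq_mul] at h
  have hf : (n.factorial : ℂ) ≠ 0 := by exact_mod_cast n.factorial_ne_zero
  have hI := Complex.I_ne_zero
  set J := ∫ θ in (0 : ℝ)..2 * Real.pi, Complex.exp (-(n * θ * Complex.I)) * f (circleMap 0 r θ)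
  have hJ : J = 2 * Real.pi * (iteratedDeriv n f 0 / n.factorial * (r : ℂ) ^ n) := by
    field_simp at h ⊢
    linear_combination h
  rw [hJ]
  field_simp

/-- Cauchy's formula on the unit circle, obtained by dominated convergence from the smaller
circles. -/
lemma taylor_coeff_eq_integral {f : ℂ → ℂ} (hd : DifferentiableOn ℂ f (ball 0 1))
    (hc : ContinuousOn f (closedBall 0 1 \ {1})) {C β : ℝ} (hβ : -1 < β) (hβ0 : β ≤ 0)
    (hC : 0 ≤ C) (hb : ∀ z : ℂ, ‖z‖ ≤ 1 → z ≠ 1 → ‖f z‖ ≤ C * ‖1 - z‖ ^ β) (n : ℕ) :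
    iteratedDeriv n f 0 / (n.factorial : ℂ)
      = (2 * (Real.pi : ℂ))⁻¹ * ∫ θ in (0 : ℝ)..2 * Real.pi,
          Complex.exp (-(n * θ * Complex.I)) * f (circleMap 0 1 θ) := by
  have hπ := Real.pi_pos
  have hev : ∀ᶠ r : ℝ in 𝓝[<] 1, 0 < r ∧ r < 1 :=
    Ioo_mem_nhdsLT (show (0 : ℝ) < 1 by norm_num)
  have hne : ∀ᵐ θ : ℝ, θ ≠ 2 * Real.pi := by simp [ae_iff]
  have hlim : Tendsto (fun r : ℝ => ∫ θ in (0 : ℝ)..2 * Real.pi,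
      Complex.exp (-(n * θ * Complex.I)) * f (circleMap 0 r θ)) (𝓝[<] 1)
      (𝓝 (∫ θ in (0 : ℝ)..2 * Real.pi,
        Complex.exp (-(n * θ * Complex.I)) * f (circleMap 0 1 θ))) := by
    refine intervalIntegral.tendsto_integral_filter_of_dominated_convergence
      (fun θ => C * ((Real.pi⁻¹) ^ β * (θ ^ β + (2 * Real.pi - θ) ^ β))) ?_ ?_ ?_ ?_
    · filter_upwards [hev] with r hr
      have hcont : Continuous fun θ : ℝ => f (circleMap 0 r θ) :=
        hd.continuousOn.comp_continuous (continuous_circleMap 0 r) fun θ => by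
          simpa [abs_of_pos hr.1] using hr.2
      have hexp : Continuous fun θ : ℝ => Complex.exp (-(n * θ * Complex.I)) := by fun_prop
      exact (hexp.mul hcont).aestronglyMeasurable
    · filter_upwards [hev] with r hr
      filter_upwards [hne] with θ hθ hmem
      rw [Set.uIoc_of_le (by positivity)] at hmem
      have hlt : θ < 2 * Real.pi := lt_of_le_of_ne hmem.2 hθ
      have hn : ‖circleMap 0 r θ‖ = r := by rw [norm_circleMap_zero, abs_of_pos hr.1]
      have hne1 : circleMap 0 r θ ≠ 1 := by
        intro h
        rw [h, norm_one] at hn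
        linarith
      have he : ‖Complex.exp (-(n * θ * Complex.I))‖ = 1 := by
        rw [show -((n : ℂ) * θ * Complex.I) = ((-(n * θ) : ℝ) : ℂ) * Complex.I by push_cast; ring]
        exact Complex.norm_exp_ofReal_mul_I _
      rw [norm_mul, he, one_mul]
      refine (hb _ (hn.trans_le hr.2.le) hne1).trans ?_
      gcongr
      exact norm_one_sub_rpow_le hβ0 hr.1.le hr.2.le hmem.1 hlt
    · have h1 : IntervalIntegrable (fun θ : ℝ => θ ^ β) volume 0 (2 * Real.pi) :=
        intervalIntegral.intervalIntegrable_rpow' hβ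
      have h2 : IntervalIntegrable (fun θ : ℝ => (2 * Real.pi - θ) ^ β) volume 0 (2 * Real.pi) := by
        simpa using (h1.comp_sub_left (2 * Real.pi)).symm
      exact ((h1.add h2).const_mul _).const_mul _
    · filter_upwards [hne] with θ hθ hmem
      rw [Set.uIoc_of_le (by positivity)] at hmem
      have hlt : θ < 2 * Real.pi := lt_of_le_of_ne hmem.2 hθ
      have hmem1 : circleMap 0 1 θ ∈ closedBall (0 : ℂ) 1 \ {1} :=
        ⟨by simp, circleMap_one_ne_one hmem.1 hlt⟩
      refine Tendsto.const_mul _ ((hc _ hmem1).tendsto.comp ?_)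
      refine tendsto_nhdsWithin_iff.2 ⟨?_, ?_⟩
      · have : Continuous fun r : ℝ => circleMap 0 r θ := by
          unfold circleMap; fun_prop
        exact this.continuousAt.tendsto.mono_left nhdsWithin_le_nhds
      · filter_upwards [hev] with r hr
        have hn : ‖circleMap 0 r θ‖ = r := by rw [norm_circleMap_zero, abs_of_pos hr.1]
        refine ⟨by simpa [hn] using hr.2.le, fun h => ?_⟩
        rw [Set.mem_singleton_iff.1 h, norm_one] at hn
        linarith [hr.2]
  have hleft : Tendsto (fun r : ℝ => iteratedDeriv n f 0 / (n.factorial : ℂ) * (r : ℂ) ^ n) (𝓝[<] 1)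
      (𝓝 (iteratedDeriv n f 0 / (n.factorial : ℂ))) := by
    have : Continuous fun r : ℝ => iteratedDeriv n f 0 / (n.factorial : ℂ) * (r : ℂ) ^ n := by
      fun_prop
    simpa using (this.tendsto 1).mono_left nhdsWithin_le_nhds
  refine tendsto_nhds_unique (hleft.congr' ?_) (hlim.const_mul _)
  filter_upwards [hev] with r hr
  exact taylor_coeff_mul_pow_eq_integral hd n hr.1 hr.2

/-- The Taylor coefficients tend to zero when the boundary singularity at `1` is integrable:
they are Fourier coefficients, so the Riemann--Lebesgue lemma applies. -/
lemma tendsto_taylor_coeff_zero {f : ℂ → ℂ} (hd : DifferentiableOn ℂ f (ball 0 1))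
    (hc : ContinuousOn f (closedBall 0 1 \ {1})) {C β : ℝ} (hβ : -1 < β) (hβ0 : β ≤ 0)
    (hC : 0 ≤ C) (hb : ∀ z : ℂ, ‖z‖ ≤ 1 → z ≠ 1 → ‖f z‖ ≤ C * ‖1 - z‖ ^ β) :
    Tendsto (fun n : ℕ => iteratedDeriv n f 0 / (n.factorial : ℂ)) atTop (𝓝 0) := by
  have hπ := Real.pi_pos
  have hRL := Real.tendsto_integral_exp_smul_cocompact
    ((Set.Ioc 0 (2 * Real.pi)).indicator fun θ => f (circleMap 0 1 θ))
  have hfreq : Tendsto (fun n : ℕ => (n : ℝ) / (2 * Real.pi)) atTop (cocompact ℝ) :=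
    (tendsto_natCast_atTop_atTop.atTop_div_const (by positivity)).mono_right atTop_le_cocompact
  have h := (hRL.comp hfreq).const_mul (2 * (Real.pi : ℂ))⁻¹
  rw [mul_zero] at h
  refine h.congr fun n => ?_
  rw [taylor_coeff_eq_integral hd hc hβ hβ0 hC hb n,
    intervalIntegral.integral_of_le (by positivity), ← integral_indicator measurableSet_Ioc]
  refine congrArg _ (integral_congr_ae (Eventually.of_forall fun θ => ?_))
  by_cases hθ : θ ∈ Set.Ioc 0 (2 * Real.pi)
  · simp only [Set.indicator_of_mem hθ]
    rw [Circle.smul_def, smul_eq_mul, Real.fourierChar_apply]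
    congr 2
    have hπ' : (Real.pi : ℂ) ≠ 0 := by exact_mod_cast Real.pi_ne_zero
    push_cast
    field_simp
  · simp [Set.indicator_of_notMem hθ]

/-! ### Formal power series -/

/-- The Taylor series at `0`, as a formal power series. -/
def taylor (f : ℂ → ℂ) : PowerSeries ℂ :=
  PowerSeries.mk fun n => iteratedDeriv n f 0 / (n.factorial : ℂ)

lemma taylor_congr {f g : ℂ → ℂ} (h : f =ᶠ[𝓝 0] g) : taylor f = taylor g := by
  ext n
  simp [taylor, h.iteratedDeriv_eq n]

lemma taylor_mul {f g : ℂ → ℂ} (hf : AnalyticAt ℂ f 0) (hg : AnalyticAt ℂ g 0) :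
    taylor (f * g) = taylor f * taylor g := by
  ext n
  rw [PowerSeries.coeff_mul, Finset.Nat.sum_antidiagonal_eq_sum_range_succ_mk]
  simp only [taylor, PowerSeries.coeff_mk]
  rw [iteratedDeriv_mul hf.contDiffAt hg.contDiffAt, Finset.sum_div]
  refine Finset.sum_congr rfl fun i hi => ?_
  have hi : i ≤ n := by simpa [Nat.lt_succ_iff] using hi
  rw [Nat.cast_choose ℂ hi]
  have h1 : (n.factorial : ℂ) ≠ 0 := by exact_mod_cast n.factorial_ne_zero
  field_simp

lemma taylor_add {f g : ℂ → ℂ} (hf : AnalyticAt ℂ f 0) (hg : AnalyticAt ℂ g 0) :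
    taylor (f + g) = taylor f + taylor g := by
  ext n
  simp only [taylor, PowerSeries.coeff_mk, map_add]
  rw [iteratedDeriv_add hf.contDiffAt hg.contDiffAt, add_div]

lemma taylor_const (c : ℂ) : taylor (fun _ => c) = PowerSeries.C c := by
  ext n
  rcases n with _ | n <;> simp [taylor, iteratedDeriv_const, PowerSeries.coeff_C]

lemma taylor_id : taylor (fun z => z) = PowerSeries.X := by
  ext n
  rcases n with _ | _ | n
  · simp [taylor]
  · simp [taylor]
  · simp [taylor, iteratedDeriv_succ', PowerSeries.coeff_X]

lemma taylor_eval (P : Polynomial ℂ) : taylor (fun z => P.eval z) = (P : PowerSeries ℂ) := by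
  have han (P : Polynomial ℂ) : AnalyticAt ℂ (fun z => P.eval z) 0 :=
    P.differentiable.analyticAt 0
  induction P using Polynomial.induction_on' with
  | add P Q hP hQ =>
    have h : (fun z => (P + Q).eval z) = (fun z => P.eval z) + fun z => Q.eval z := by
      ext; simp
    rw [h, taylor_add (han P) (han Q), hP, hQ, Polynomial.coe_add]
  | monomial n c =>
    induction n generalizing c with
    | zero => simp [taylor_const]
    | succ n ih =>
      have h : (fun z => (Polynomial.monomial (n + 1) c).eval z)
          = (fun z => (Polynomial.monomial n c).eval z) * fun z => z := by
        ext; simp [pow_succ, mul_assoc]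
      rw [h, taylor_mul (g := fun z => z) (han _) analyticAt_id, ih c, taylor_id,
        ← Polynomial.monomial_mul_X, Polynomial.coe_mul, Polynomial.coe_X]

/-- Multiplication by `(1 - X)^q` is the `q`-th backward difference. -/
lemma coeff_one_sub_X_pow_mul {q n : ℕ} (hq : q = 1 ∨ q = 2) (hn : q ≤ n) (U : ℕ → ℂ) :
    PowerSeries.coeff n ((1 - PowerSeries.X) ^ q * PowerSeries.mk U) = perturbation q U n := by
  rcases hq with rfl | rfl
  · obtain ⟨m, rfl⟩ : ∃ m, n = m + 1 := ⟨n - 1, by omega⟩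
    rw [perturbation_one, pow_one, sub_mul, one_mul, map_sub, PowerSeries.coeff_succ_X_mul]
    simp
  · obtain ⟨m, rfl⟩ : ∃ m, n = m + 1 + 1 := ⟨n - 2, by omega⟩
    rw [perturbation_two, show (1 - PowerSeries.X) ^ 2 * PowerSeries.mk U
      = PowerSeries.mk U - (PowerSeries.X * PowerSeries.mk U + PowerSeries.X * PowerSeries.mk U)
        + PowerSeries.X * (PowerSeries.X * PowerSeries.mk U) by ring]
    simp only [map_add, map_sub, PowerSeries.coeff_succ_X_mul, PowerSeries.coeff_mk]
    simp [two_mul]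

/-- A numerical solution satisfies, as a formal power series, a linear equation whose right-hand
side is determined up to a polynomial, which absorbs the starting values. -/
lemma IsNumericalSolution.exists_polynomial {F : Formula} {p q : ℕ} {α lam ρ κ τ : ℝ}
    (hq : q = 1 ∨ q = 2) (hτ : 0 < τ) {U : ℕ → ℂ}
    (hU : IsNumericalSolution F p q α lam ρ κ τ U) :
    ∃ P : Polynomial ℂ,
      (taylor (omega F p α 1) - PowerSeries.C ((τ ^ α : ℝ) : ℂ) *
          (PowerSeries.C ((lam : ℂ) + ρ) - PowerSeries.C ((ρ : ℂ) + κ) * (1 - PowerSeries.X) ^ q))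
        * PowerSeries.mk U * (1 - PowerSeries.X)
      = PowerSeries.C (U 0) * taylor (omega F p α 1) + (P : PowerSeries ℂ) * (1 - PowerSeries.X) := by
  set W := taylor (omega F p α 1) with hW
  set s : ℂ := ((τ ^ α : ℝ) : ℂ) with hs
  have hs0 : s ≠ 0 := by
    rw [hs]; exact_mod_cast (Real.rpow_pos_of_pos hτ α).ne'
  set R : PowerSeries ℂ := PowerSeries.mk (fun j => U j - U 0) * W
    - PowerSeries.C s * (PowerSeries.C ((lam : ℂ) + ρ) * PowerSeries.mk U
      - PowerSeries.C ((ρ : ℂ) + κ) * ((1 - PowerSeries.X) ^ q * PowerSeries.mk U)) with hR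
  have hRcoeff (n : ℕ) (hn : q ≤ n) : PowerSeries.coeff n R = 0 := by
    have h := hU n hn
    rw [hR, map_sub, PowerSeries.coeff_C_mul, map_sub, PowerSeries.coeff_C_mul,
      PowerSeries.coeff_C_mul, coeff_one_sub_X_pow_mul hq hn, PowerSeries.coeff_mul,
      Finset.Nat.sum_antidiagonal_eq_sum_range_succ_mk, PowerSeries.coeff_mk, ← h, ← mul_assoc,
      mul_one_div_cancel hs0, one_mul, sub_eq_zero]
    refine Finset.sum_congr rfl fun j _ => ?_
    simp [hW, taylor, weight, mul_comm]
  have hRP : R = (PowerSeries.trunc q R : PowerSeries ℂ) := by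
    ext n
    rw [Polynomial.coeff_coe, PowerSeries.coeff_trunc]
    split_ifs with h
    · rfl
    · exact hRcoeff n (not_lt.1 h)
  refine ⟨PowerSeries.trunc q R, ?_⟩
  rw [← hRP, hR]
  have hgeom : PowerSeries.mk (fun j => U j - U 0)
      = PowerSeries.mk U - PowerSeries.C (U 0) * PowerSeries.mk 1 := by
    ext n
    simp [PowerSeries.coeff_C_mul]
  rw [hgeom]
  linear_combination (PowerSeries.C (U 0) * W) * PowerSeries.mk_one_mul_one_sub_eq_one ℂ

lemma taylor_denom (q : ℕ) (lam ρ κ : ℝ) :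
    taylor (denom q lam ρ κ) = PowerSeries.C ((lam : ℂ) + ρ)
      - PowerSeries.C ((ρ : ℂ) + κ) * (1 - PowerSeries.X) ^ q := by
  have h := taylor_eval (Polynomial.C ((lam : ℂ) + ρ)
    - Polynomial.C ((ρ : ℂ) + κ) * (1 - Polynomial.X) ^ q)
  have hd : denom q lam ρ κ = fun z => ((lam : ℂ) + ρ) - ((ρ : ℂ) + κ) * (1 - z) ^ q := rfl
  rw [hd]
  simpa using h

/-! ### Stability -/

lemma differentiable_denom (q : ℕ) (lam ρ κ : ℝ) : Differentiable ℂ (denom q lam ρ κ) := by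
  unfold denom
  fun_prop

/-- If the characteristic function has no zero in the closed unit disk, numerical solutions
decay. -/
lemma isStable_of_forall_ne {F : Formula} {p q : ℕ} {α lam ρ κ τ : ℝ}
    (hα0 : 0 < α) (hα1 : α ≤ 1) (hp : p = 1 ∨ p = 2) (hq : q = 1 ∨ q = 2) (hτ : 0 < τ)
    (hne : ∀ z : ℂ, ‖z‖ ≤ 1 → omega F p α 1 z ≠ ((τ ^ α : ℝ) : ℂ) * denom q lam ρ κ z) :
    IsStable F p q α lam ρ κ τ := by
  intro U hU
  obtain ⟨P, hP⟩ := hU.exists_polynomial hq hτ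
  rw [← taylor_denom] at hP
  set s : ℂ := ((τ ^ α : ℝ) : ℂ)
  set ω := omega F p α 1
  set D := denom q lam ρ κ
  have hωc : ContinuousOn ω (closedBall 0 1) := continuousOn_omega hα0 hp
  have hωd : DifferentiableOn ℂ ω (ball 0 1) := differentiableOn_omega hα0 hp
  have hDd : Differentiable ℂ D := differentiable_denom q lam ρ κ
  have hHc : ContinuousOn (fun z => ω z - s * D z) (closedBall 0 1) :=
    hωc.sub (continuousOn_const.mul hDd.continuous.continuousOn)
  have hH0 (z : ℂ) (hz : ‖z‖ ≤ 1) : ω z - s * D z ≠ 0 := sub_ne_zero.2 (hne z hz)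
  let f : ℂ → ℂ := fun z => (U 0 * (ω z / (1 - z)) + P.eval z) / (ω z - s * D z)
  have h1 {z : ℂ} (hz : z ≠ 1) : 1 - z ≠ 0 := sub_ne_zero.2 hz.symm
  have hball {z : ℂ} (hz : z ∈ ball (0 : ℂ) 1) : ‖z‖ < 1 := by simpa using hz
  have hball1 {z : ℂ} (hz : z ∈ ball (0 : ℂ) 1) : z ≠ 1 := by
    rintro rfl
    simpa using hball hz
  have hHd : DifferentiableOn ℂ (fun z => ω z - s * D z) (ball 0 1) :=
    hωd.sub (hDd.differentiableOn.const_mul s)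
  have hfd : DifferentiableOn ℂ f (ball 0 1) := by
    refine DifferentiableOn.div ?_ hHd fun z hz => hH0 z (hball hz).le
    refine DifferentiableOn.add ?_ P.differentiable.differentiableOn
    refine DifferentiableOn.const_mul (hωd.div ?_ fun z hz => h1 (hball1 hz)) _
    fun_prop
  have hfc : ContinuousOn f (closedBall 0 1 \ {1}) := by
    refine ContinuousOn.div ?_ (hHc.mono Set.sdiff_subset) fun z hz => hH0 z (by simpa using hz.1)
    refine ContinuousOn.add ?_ P.continuous.continuousOn
    refine continuousOn_const.mul ((hωc.mono Set.sdiff_subset).div ?_ fun z hz => h1 hz.2)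
    fun_prop
  -- The solution is the sequence of Taylor coefficients of `f`.
  have hfU : taylor f = PowerSeries.mk U := by
    have h0 : ball (0 : ℂ) 1 ∈ 𝓝 0 := ball_mem_nhds 0 one_pos
    have hωa : AnalyticAt ℂ ω 0 := hωd.analyticAt h0
    have hDa : AnalyticAt ℂ D 0 := hDd.analyticAt 0
    have hHa : AnalyticAt ℂ (fun z => ω z - s * D z) 0 := hHd.analyticAt h0
    have hfa : AnalyticAt ℂ f 0 := hfd.analyticAt h0
    have hXa : AnalyticAt ℂ (fun z : ℂ => 1 - z) 0 := by fun_prop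
    have hPa : AnalyticAt ℂ (fun z => P.eval z) 0 := P.differentiable.analyticAt 0
    have hX : taylor (fun z => 1 - z) = 1 - PowerSeries.X := by
      have h := taylor_eval (1 - Polynomial.X)
      simpa using h
    have hHt : taylor (fun z => ω z - s * D z) = taylor ω - PowerSeries.C s * taylor D := by
      have : (fun z => ω z - s * D z) = ω + (fun _ => -s) * D := by
        ext; simp [sub_eq_add_neg]
      rw [this, taylor_add hωa (analyticAt_const.mul hDa), taylor_mul analyticAt_const hDa,
        taylor_const, map_neg]
      ring
    have hprod : (fun z => ω z - s * D z) * f * (fun z => 1 - z)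
        =ᶠ[𝓝 0] (fun _ => U 0) * ω + (fun z => P.eval z) * fun z => 1 - z := by
      filter_upwards [h0] with z hz
      have := hH0 z (hball hz).le
      have := h1 (hball1 hz)
      simp only [f, Pi.mul_apply, Pi.add_apply]
      field_simp
    have ht := taylor_congr hprod
    rw [taylor_mul (hHa.mul hfa) hXa, taylor_mul hHa hfa,
      taylor_add (analyticAt_const.mul hωa) (hPa.mul hXa), taylor_mul analyticAt_const hωa,
      taylor_mul hPa hXa, taylor_const, taylor_eval, hX, hHt, ← hP] at ht
    have hX0 : (1 - PowerSeries.X : PowerSeries ℂ) ≠ 0 := by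
      intro h
      simpa using congrArg PowerSeries.constantCoeff h
    have hHt0 : taylor ω - PowerSeries.C s * taylor D ≠ 0 := by
      rw [← hHt]
      intro h
      have := congrArg (PowerSeries.coeff 0) h
      exact hH0 0 (by simp) (by simpa [taylor] using this)
    exact mul_left_cancel₀ hHt0 (mul_right_cancel₀ hX0 ht)
  obtain ⟨c, hc0, hc⟩ : ∃ c : ℝ, 0 < c ∧ ∀ z : ℂ, ‖z‖ ≤ 1 → c ≤ ‖ω z - s * D z‖ := by
    obtain ⟨z₀, hz₀, hmin⟩ := (isCompact_closedBall (0 : ℂ) 1).exists_isMinOn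
      ⟨0, by simp⟩ hHc.norm
    exact ⟨_, norm_pos_iff.2 (hH0 z₀ (by simpa using hz₀)), fun z hz => hmin (by simpa using hz)⟩
  obtain ⟨B, hB0, hB⟩ : ∃ B : ℝ, 0 ≤ B ∧ ∀ z : ℂ, ‖z‖ ≤ 1 → ‖P.eval z‖ ≤ B := by
    obtain ⟨B, hB⟩ := (isCompact_closedBall (0 : ℂ) 1).exists_bound_of_continuousOn
      P.continuous.continuousOn
    exact ⟨B, (norm_nonneg _).trans (hB 0 (by simp)), fun z hz => hB z (by simpa using hz)⟩
  obtain ⟨A, hA0, hA⟩ : ∃ A : ℝ, 0 ≤ A ∧ ∀ z : ℂ, ‖z‖ ≤ 1 → ‖ω z‖ ≤ A * ‖1 - z‖ ^ α :=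
    exists_norm_omega_le hα0 hp
  have hfb (z : ℂ) (hz : ‖z‖ ≤ 1) (hz1 : z ≠ 1) :
      ‖f z‖ ≤ (‖U 0‖ * A + B * 2 ^ (1 - α)) / c * ‖1 - z‖ ^ (α - 1) := by
    have hpos : 0 < ‖1 - z‖ := norm_pos_iff.2 (h1 hz1)
    have h2 : ‖1 - z‖ ≤ 2 := by
      refine (norm_sub_le _ _).trans ?_
      rw [norm_one]; linarith
    have h3 : ‖U 0 * (ω z / (1 - z))‖ ≤ ‖U 0‖ * A * ‖1 - z‖ ^ (α - 1) := by
      rw [norm_mul, norm_div, Real.rpow_sub_one hpos.ne', mul_assoc]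
      refine mul_le_mul_of_nonneg_left ?_ (norm_nonneg _)
      rw [← mul_div_assoc]
      exact div_le_div_of_nonneg_right (hA z hz) hpos.le
    have h4 : ‖P.eval z‖ ≤ B * 2 ^ (1 - α) * ‖1 - z‖ ^ (α - 1) := by
      have h5 : 1 ≤ (2 : ℝ) ^ (1 - α) * ‖1 - z‖ ^ (α - 1) := by
        calc (1 : ℝ) = (2 : ℝ) ^ (1 - α) * (2 : ℝ) ^ (α - 1) := by
              rw [← Real.rpow_add two_pos]; simp
          _ ≤ _ := mul_le_mul_of_nonneg_left
              (Real.rpow_le_rpow_of_nonpos hpos h2 (by linarith)) (by positivity)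
      rw [mul_assoc]
      exact (hB z hz).trans (le_mul_of_one_le_right hB0 h5)
    have h5 : ‖U 0 * (ω z / (1 - z)) + P.eval z‖
        ≤ (‖U 0‖ * A + B * 2 ^ (1 - α)) * ‖1 - z‖ ^ (α - 1) := by
      refine (norm_add_le _ _).trans ?_
      linarith
    calc ‖f z‖ = ‖U 0 * (ω z / (1 - z)) + P.eval z‖ / ‖ω z - s * D z‖ := norm_div _ _
      _ ≤ ((‖U 0‖ * A + B * 2 ^ (1 - α)) * ‖1 - z‖ ^ (α - 1)) / c := by
          gcongr
          exact hc z hz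
      _ = _ := by ring
  have hlim := tendsto_taylor_coeff_zero hfd hfc (by linarith) (by linarith) (by positivity) hfb
  refine hlim.congr fun n => ?_
  simpa [taylor] using congrArg (PowerSeries.coeff n) hfU

end SemiImplicit

end

theorem theorem2p3 (F : SemiImplicit.Formula) (p q : ℕ) (α lam ρ κ : ℝ)
    (hα0 : 0 < α) (hα1 : α ≤ 1) (hlam : lam < 0) (hρ : ρ ≤ 0)
    (hp : p = 1 ∨ p = 2)
    (hκ : (q = 1 ∧ (lam - ρ) / 2 < κ) ∨ (q = 2 ∧ (lam - 3 * ρ) / 4 < κ)) :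
    SemiImplicit.IsUnconditionallyStable F p q α lam ρ κ ∧
    (∀ z : ℂ, ‖z‖ ≤ 1 → SemiImplicit.denom q lam ρ κ z ≠ 0) ∧
    (∀ τ : ℝ, 0 < τ → (τ : ℂ) ∈ SemiImplicit.stabilityRegion F p q α lam ρ κ) := by
  have hroot {τ : ℝ} (hτ : 0 < τ) (z : ℂ) (hz : ‖z‖ ≤ 1) :
      SemiImplicit.omega F p α 1 z ≠ ((τ ^ α : ℝ) : ℂ) * SemiImplicit.denom q lam ρ κ z :=
    SemiImplicit.omega_ne_mul_denom hα0 hα1 hlam hρ hp hκ hz (Real.rpow_pos_of_pos hτ α)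
  have hden (z : ℂ) (hz : ‖z‖ ≤ 1) : SemiImplicit.denom q lam ρ κ z ≠ 0 :=
    SemiImplicit.denom_ne_zero hlam hρ hκ hz
  refine ⟨fun τ hτ => SemiImplicit.isStable_of_forall_ne hα0 hα1 hp
    (hκ.imp And.left And.left) hτ (hroot hτ), hden, ?_⟩
  rintro τ hτ ⟨z, hz, h⟩
  rw [eq_div_iff (hden z hz), ← Complex.ofReal_cpow hτ.le] at h
  exact hroot hτ z hz h.symm
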